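/- A \emph{decorated Gauss diagram} $G^d$ consists of two finite families $\mathcal M^+,\mathcal M^-$ of disjoint oriented circles, finitely many chords, each joining a point of a circle of $\mathcal M^+$ to a point of a circle of $\mathcal M^-$ (all endpoints distinct) and each carrying a sign $\pm1$, and a coloring of the cycles of the diagram, defined below, by a finite set of colors. The \emph{ribbon graph} $\Gamma$ of the diagram is the oriented surface with boundary obtained from the oriented annuli $\mu\times[-1,1]$, $\mu\in\mathcal M^\pm$, by identifying, for each chord with ends $p^\pm$, small squares around $p^\pm$ with one square $[-1,1]^2$, preserving orientation, so that the circle of $\mathcal M^+$ becomes the horizontal axis in the positive $x$ direction, and the circle of $\mathcal M^-$ becomes the vertical axis, in the positive $y$ direction if the chord is positive and in the negative $y$ direction if it is negative. The \emph{cycles} are the boundary components of $\Gamma$. The \emph{associated surface} $S(G^d)$ is the closed oriented surface obtained from $\Gamma$ by taking, for each color, an oriented sphere with as many holes as there are cycles of this color and gluing it, compatibly with the orientations, to these cycles (a color without cycles contributes a closed sphere). Let $|h|$ be the number of chords, $|c|$ the number of cycles, and let the excess $\Delta_c$ be $|c|$ minus the number of colors. \textbf{Proposition.} The Euler characteristic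 of $S(G^d)$ is $$\chi(S(G^d)) = 2-2\Bigl(1+\Delta_c+\tfrac12(|h|-|c|)\Bigr) = |c|-|h|-2\Delta_c .$$ Consequently, if $S(G^d)$ is connected, its genus (half of its first Betti number) is $$g_{S(G^d)} = 1+\Delta_c+\tfrac12\,(|h|-|c|).$$ -/

import Mathlib

/-!  Closed and bordered oriented surfaces presented by polygons, and their cellular invariants.  -/

/-- A finite oriented polygonal surface, possibly with boundary.  `Side` is the set of all sides
of finitely many oriented polygons; `next s` is the side following `s` counterclockwise around its
polygon, so that the polygons are the cycles of `next`.  The sides `s` and `glue s`, if different,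
are identified by an orientation-reversing homeomorphism (the head of one goes to the tail of the
other); the sides with `glue s = s` are not glued to anything: they form the boundary. -/
structure PolygonalSurface where
  Side : Type
  [fintypeSide : Fintype Side]
  next : Equiv.Perm Side
  glue : Equiv.Perm Side
  glue_glue : ∀ s, glue (glue s) = s

attribute [instance] PolygonalSurface.fintypeSide

namespace PolygonalSurface

variable (S : PolygonalSurface)

/-- A side which lies on the boundary of the surface. -/
def IsFree (s : S.Side) : Prop := S.glue s = s

/-- A surface without boundary. -/
def IsClosed : Prop := ∀ s, ¬ S.IsFree s

/-- The identifications of the points of the polygons.  Each polygon is cut into sectors, one for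
each of its sides: the point `(t, r)` of the sector of `s` is the point at relative distance `r`
from the centre of the polygon towards the point at time `t` of the side `s`. -/
inductive Rel : (Σ _ : S.Side, unitInterval × unitInterval) →
    (Σ _ : S.Side, unitInterval × unitInterval) → Prop
  | centre (s : S.Side) (t t' : unitInterval) : Rel ⟨s, (t, 0)⟩ ⟨s, (t', 0)⟩
  | spoke (s : S.Side) (r : unitInterval) : Rel ⟨s, (1, r)⟩ ⟨S.next s, (0, r)⟩
  | glue (s : S.Side) (hs : ¬ S.IsFree s) (t : unitInterval) :
      Rel ⟨s, (t, 1)⟩ ⟨S.glue s, (unitInterval.symm t, 1)⟩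

/-- The topological space obtained from the polygons by gluing their sides. -/
def Realization : Type := Quot S.Rel

instance : TopologicalSpace S.Realization := inferInstanceAs (TopologicalSpace (Quot S.Rel))

/-- The polygons. -/
abbrev Face : Type := Quotient (Equiv.Perm.SameCycle.setoid S.next)

/-- The edges after gluing. -/
abbrev Edge : Type := Quotient (Equiv.Perm.SameCycle.setoid S.glue)

/-- The corner relation: the tail of a glued side `s` is the head of `glue s`, that is, the tail
of `next (glue s)`. -/
def CornerRel (s t : S.Side) : Prop := ¬ S.IsFree s ∧ t = S.next (S.glue s)

/-- The vertices after gluing, as classes of corners of polygons; a corner is represented by the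
side which starts at it. -/
abbrev Vertex : Type := Quot S.CornerRel

/-- The vertex at which a side starts. -/
def tail (s : S.Side) : S.Vertex := Quot.mk _ s

/-- The vertex at which a side ends. -/
def head (s : S.Side) : S.Vertex := S.tail (S.next s)

/-- The Euler characteristic, computed from the cell decomposition. -/
noncomputable def eulerChar : ℤ :=
  (Nat.card S.Vertex : ℤ) - Nat.card S.Edge + Nat.card S.Face

/-- Cellular 1-cochains with rational coefficients: functions on oriented edges which change sign
with the orientation. -/
def cochains₁ : Submodule ℚ (S.Side → ℚ) where
  carrier := {f | ∀ s, ¬ S.IsFree s → f (S.glue s) = - f s}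
  add_mem' := by
    intro f g hf hg s hs
    simp only [Pi.add_apply, hf s hs, hg s hs]
    ring
  zero_mem' := by
    intro s _
    simp
  smul_mem' := by
    intro a f hf s hs
    simp only [Pi.smul_apply, hf s hs, smul_neg]

theorem tail_glue (s : S.Side) (hs : ¬ S.IsFree s) : S.tail (S.glue s) = S.head s := by
  have h : S.CornerRel (S.glue s) (S.next s) := by
    refine ⟨fun h => hs ?_, by rw [S.glue_glue]⟩
    exact S.glue.injective h
  exact Quot.sound h

theorem head_glue (s : S.Side) (hs : ¬ S.IsFree s) : S.head (S.glue s) = S.tail s :=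
  (Quot.sound (show S.CornerRel s (S.next (S.glue s)) from ⟨hs, rfl⟩)).symm

/-- The coboundary of a 0-cochain. -/
def d₀ : (S.Vertex → ℚ) →ₗ[ℚ] (S.Side → ℚ) where
  toFun f := fun s => f (S.head s) - f (S.tail s)
  map_add' := by
    intro f g
    ext s
    simp only [Pi.add_apply]
    ring
  map_smul' := by
    intro a f
    ext s
    simp only [Pi.smul_apply, smul_eq_mul, RingHom.id_apply]
    ring

open Classical in
/-- The coboundary of a 1-cochain: its sum over the boundary of each polygon. -/
noncomputable def d₁ : (S.Side → ℚ) →ₗ[ℚ] (S.Face → ℚ) where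
  toFun f := fun F => ∑ s : S.Side, if (Quotient.mk _ s : S.Face) = F then f s else 0
  map_add' := by
    intro f g
    ext F
    simp only [Pi.add_apply, ← Finset.sum_add_distrib]
    refine Finset.sum_congr rfl fun s _ => ?_
    split_ifs <;> simp
  map_smul' := by
    intro a f
    ext F
    simp only [Pi.smul_apply, smul_eq_mul, RingHom.id_apply, Finset.mul_sum]
    refine Finset.sum_congr rfl fun s _ => ?_
    split_ifs <;> simp

/-- The 1-cocycles. -/
noncomputable def cocycles : Submodule ℚ (S.Side → ℚ) := S.cochains₁ ⊓ LinearMap.ker S.d₁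

/-- The 1-coboundaries. -/
def coboundaries : Submodule ℚ (S.Side → ℚ) := LinearMap.range S.d₀

theorem coboundaries_le_cocycles : S.coboundaries ≤ S.cocycles := by
  classical
  rintro _ ⟨f, rfl⟩
  refine Submodule.mem_inf.2 ⟨?_, ?_⟩
  · intro s hs
    simp only [d₀, LinearMap.coe_mk, AddHom.coe_mk, S.tail_glue s hs, S.head_glue s hs, neg_sub]
  rw [LinearMap.mem_ker]
  ext F
  have hface : ∀ s : S.Side, (Quotient.mk _ (S.next s) : S.Face) = Quotient.mk _ s := fun s =>
    Quotient.sound (show S.next.SameCycle (S.next s) s from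
      (Equiv.Perm.sameCycle_apply_left).2 (Equiv.Perm.SameCycle.refl _ _))
  have key : ∑ s : S.Side, (if (Quotient.mk _ s : S.Face) = F then f (S.head s) else 0)
      = ∑ s : S.Side, (if (Quotient.mk _ s : S.Face) = F then f (S.tail s) else 0) := by
    rw [← Equiv.sum_comp S.next
      (fun s => if (Quotient.mk _ s : S.Face) = F then f (S.tail s) else 0)]
    refine Finset.sum_congr rfl fun s _ => ?_
    rw [hface s]
    rfl
  have h2 : (S.d₁ (S.d₀ f)) F = ∑ s : S.Side,
      ((if (Quotient.mk _ s : S.Face) = F then f (S.head s) else 0)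
        - (if (Quotient.mk _ s : S.Face) = F then f (S.tail s) else 0)) := by
    refine Finset.sum_congr rfl fun s _ => ?_
    split_ifs
    · rfl
    · simp
  rw [h2, Finset.sum_sub_distrib, key, sub_self]
  rfl

/-- The first cellular cohomology group with rational coefficients. -/
abbrev FirstCohomology : Type := S.cocycles ⧸ S.coboundaries.submoduleOf S.cocycles

/-- A surface has genus `g` if it is closed and connected and its first Betti number is `2g`
(surfaces here are oriented by construction). -/
def HasGenus (g : ℕ) : Prop :=
  S.IsClosed ∧ ConnectedSpace S.Realization ∧ Module.finrank ℚ S.FirstCohomology = 2 * g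

/-!  Boundary components.  -/

/-- From a glued side, rotate about its tail to the next side starting at the same vertex;
from a free side, pass to the following side of its polygon. -/
def walk : Equiv.Perm S.Side := S.glue.trans S.next

/-- The boundary sides. -/
abbrev Free : Type := {s : S.Side // S.IsFree s}

theorem exists_return (s : S.Free) : ∃ k : ℕ, S.IsFree ((S.walk ^ (k + 1)) s.1) := by
  refine ⟨orderOf S.walk - 1, ?_⟩
  rw [Nat.sub_add_cancel (orderOf_pos S.walk), pow_orderOf_eq_one]
  exact s.2

open Classical in
/-- The boundary side which follows a given one: leave it at its head and rotate about this vertex,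
from polygon to polygon, up to the first boundary side. -/
noncomputable def nextFreeFun (s : S.Free) : S.Free :=
  ⟨(S.walk ^ (Nat.find (S.exists_return s) + 1)) s.1, Nat.find_spec (S.exists_return s)⟩

open Classical in
theorem nextFreeFun_aux (s t : S.Free) (h : S.nextFreeFun s = S.nextFreeFun t)
    (hle : Nat.find (S.exists_return s) ≤ Nat.find (S.exists_return t)) : s = t := by
  obtain ⟨d, hd⟩ := Nat.exists_eq_add_of_le hle
  have h1 : (S.walk ^ (Nat.find (S.exists_return s) + 1)) s.1
      = (S.walk ^ (Nat.find (S.exists_return s) + 1)) ((S.walk ^ d) t.1) := by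
    rw [← Equiv.Perm.mul_apply, ← pow_add,
      show Nat.find (S.exists_return s) + 1 + d = Nat.find (S.exists_return t) + 1 by omega]
    exact congrArg Subtype.val h
  have h2 : s.1 = (S.walk ^ d) t.1 := (Equiv.injective _ h1)
  cases d with
  | zero => exact Subtype.ext (by simpa using h2)
  | succ d =>
    exact absurd (h2 ▸ s.2) (Nat.find_min (S.exists_return t) (by omega))

open Classical in
theorem nextFreeFun_injective : Function.Injective S.nextFreeFun := by
  intro s t h
  rcases le_total (Nat.find (S.exists_return s)) (Nat.find (S.exists_return t)) with hle | hle
  · exact S.nextFreeFun_aux s t h hle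
  · exact (S.nextFreeFun_aux t s h.symm hle).symm

/-- The permutation of the boundary sides which moves along the boundary by one side. -/
noncomputable def nextFree : Equiv.Perm S.Free :=
  Equiv.ofBijective S.nextFreeFun (Finite.injective_iff_bijective.1 S.nextFreeFun_injective)

/-- The boundary components, as cyclic sequences of boundary sides. -/
abbrev BoundaryComponent : Type := Quotient (Equiv.Perm.SameCycle.setoid S.nextFree)

/-- The boundary component that contains a boundary side. -/
noncomputable def component (s : S.Free) : S.BoundaryComponent := Quotient.mk _ s

noncomputable instance : Fintype S.Free := Fintype.ofFinite _
noncomputable instance : Fintype S.BoundaryComponent := Fintype.ofFinite _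

/-!  Gluing spheres with holes to the boundary.  -/

section Capping

variable {S} {m : ℕ} (col : S.BoundaryComponent → Fin m)

/-- The colour of the end of a leg, see `Cut`. -/
def legColour : S.BoundaryComponent ⊕ Fin m → Fin m := Sum.elim col id

/-- For each colour, the sphere whose holes are the boundary components of this colour is cut
open to a polygon along a star of arcs (legs), which join a central point to the holes and to one
more point of the sphere.  The choices that this involves: the cyclic order `rot` of the legs
around each centre, and the point of each hole to which its leg goes, given by a side of the rim
that has an end at this point. -/
structure Cut where
  rot : Equiv.Perm (S.BoundaryComponent ⊕ Fin m)
  legColour_rot : ∀ l, legColour col (rot l) = legColour col l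
  sameCycle_rot : ∀ l l', legColour col l = legColour col l' → rot.SameCycle l l'
  base : S.BoundaryComponent → S.Free
  component_base : ∀ i, S.component (base i) = i

/-- The sides of the polygons into which the spheres with holes are cut: `rim s` runs along a hole
and will be glued to the boundary side `s`; the two copies of a leg are directed from the
centre (`out`) and to the centre (`back`). -/
inductive CapSide (S : PolygonalSurface) (m : ℕ) : Type
  | rim (s : S.Free)
  | out (l : S.BoundaryComponent ⊕ Fin m)
  | back (l : S.BoundaryComponent ⊕ Fin m)

/-- An enumeration of the sides of the polygons. -/
def CapSide.equiv : CapSide S m ≃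
    S.Free ⊕ ((S.BoundaryComponent ⊕ Fin m) ⊕ (S.BoundaryComponent ⊕ Fin m)) where
  toFun
    | .rim s => .inl s
    | .out l => .inr (.inl l)
    | .back l => .inr (.inr l)
  invFun
    | .inl s => .rim s
    | .inr (.inl l) => .out l
    | .inr (.inr l) => .back l
  left_inv := by rintro (_ | _ | _) <;> rfl
  right_inv := by rintro (_ | _ | _) <;> rfl

noncomputable instance : Fintype (CapSide S m) := Fintype.ofEquiv _ CapSide.equiv.symm

variable {col}

open Classical in
/-- Counterclockwise around the polygon of a colour: go out along a leg; if the leg ends at a hole,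
run once around the hole, from its base side backwards along the given boundary component; if it
ends at a point, turn there; go back along the same leg; then take the next leg. -/
noncomputable def Cut.capNext (κ : Cut col) : Equiv.Perm (CapSide S m) where
  toFun
    | .out (.inl i) => .rim (κ.base i)
    | .out (.inr k) => .back (.inr k)
    | .rim s =>
        let t := S.nextFree.symm s
        if κ.base (S.component t) = t then .back (.inl (S.component t)) else .rim t
    | .back l => .out (κ.rot l)
  invFun
    | .out l => .back (κ.rot.symm l)
    | .rim t => if κ.base (S.component t) = t then .out (.inl (S.component t))
        else .rim (S.nextFree t)
    | .back (.inl i) => .rim (S.nextFree (κ.base i))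
    | .back (.inr k) => .out (.inr k)
  left_inv := by
    rintro (s | (i | k) | l)
    · by_cases h : κ.base (S.component (S.nextFree.symm s)) = S.nextFree.symm s <;> simp [h]
    · simp [κ.component_base]
    · rfl
    · simp
  right_inv := by
    rintro (t | l | (i | k))
    · by_cases h : κ.base (S.component t) = t <;> simp [h]
    · simp
    · simp [κ.component_base]
    · rfl

open Classical in
/-- Each rim side is glued to its boundary side, and the two copies of each leg to each other. -/
noncomputable def capGlueFun : S.Side ⊕ CapSide S m → S.Side ⊕ CapSide S m
  | .inl s => if h : S.IsFree s then .inr (.rim ⟨s, h⟩) else .inl (S.glue s)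
  | .inr (.rim s) => .inl s.1
  | .inr (.out l) => .inr (.back l)
  | .inr (.back l) => .inr (.out l)

theorem capGlueFun_involutive :
    Function.Involutive (capGlueFun : S.Side ⊕ CapSide S m → S.Side ⊕ CapSide S m) := by
  rintro (s | s | l | l)
  · by_cases h : S.IsFree s
    · simp [capGlueFun, h]
    · have h' : ¬ S.IsFree (S.glue s) := fun h' => h (S.glue.injective h')
      simp [capGlueFun, h, h', S.glue_glue]
  · simp [capGlueFun, s.2]
  · rfl
  · rfl

/-- The surface obtained from `S` by gluing, for each colour, a sphere with holes to all
boundary components of this colour. -/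
noncomputable def capped (κ : Cut col) : PolygonalSurface where
  Side := S.Side ⊕ CapSide S m
  next := Equiv.sumCongr S.next κ.capNext
  glue := capGlueFun_involutive.toPerm
  glue_glue := capGlueFun_involutive

end Capping

/-- Every colouring of a finite set is preserved by a permutation whose cycles are the classes of
equal colour. -/
theorem exists_rot {α : Type} [Finite α] {m : ℕ} (c : α → Fin m) :
    ∃ r : Equiv.Perm α, (∀ l, c (r l) = c l) ∧ ∀ l l', c l = c l' → r.SameCycle l l' := by
  have key : ∀ k : Fin m, ∃ r : Equiv.Perm {l // c l = k}, ∀ l l', r.SameCycle l l' := by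
    intro k
    obtain ⟨n, ⟨e⟩⟩ := Finite.exists_equiv_fin {l // c l = k}
    refine ⟨e.permCongr.symm (finRotate n), fun l l' => ?_⟩
    have h : (finRotate n).SameCycle (e l) (e l') := by
      match n, e with
      | 0, e => exact (e l).elim0
      | 1, e => exact (Subsingleton.elim (e l) (e l')) ▸ Equiv.Perm.SameCycle.refl _ _
      | n + 2, e =>
        exact isCycle_finRotate.sameCycle
          (Equiv.Perm.mem_support.1 (by rw [support_finRotate]; simp))
          (Equiv.Perm.mem_support.1 (by rw [support_finRotate]; simp))
    obtain ⟨i, hi⟩ := h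
    refine ⟨i, ?_⟩
    have : ∀ x, (e.permCongr.symm (finRotate n) ^ i) x = e.symm ((finRotate n ^ i) (e x)) := by
      intro x
      have := map_zpow (e.symm.permCongrHom) (finRotate n) i
      have h2 := congrArg (fun p => p x) this
      exact h2.symm
    rw [this, hi, Equiv.symm_apply_apply]
  choose r hr using key
  let r₀ : α → α := fun l => (r (c l) ⟨l, rfl⟩).1
  have h₀ : ∀ (k : Fin m) (x : {l // c l = k}), r₀ x.1 = (r k x).1 := by
    rintro k ⟨x, rfl⟩
    rfl
  have hc : ∀ l, c (r₀ l) = c l := fun l => (r (c l) ⟨l, rfl⟩).2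
  have hinj : Function.Injective r₀ := by
    intro l l' h
    have hcl : c l' = c l := by rw [← hc l', ← h, hc l]
    have h1 := h₀ (c l) ⟨l', hcl⟩
    have h2 := h₀ (c l) ⟨l, rfl⟩
    have h3 : r (c l) ⟨l, rfl⟩ = r (c l) ⟨l', hcl⟩ := Subtype.ext (by rw [← h1, ← h2, h])
    exact congrArg Subtype.val ((r (c l)).injective h3)
  let R : Equiv.Perm α := Equiv.ofBijective r₀ (Finite.injective_iff_bijective.1 hinj)
  refine ⟨R, hc, fun l l' h => ?_⟩
  obtain ⟨i, hi⟩ := (hr (c l) ⟨l, rfl⟩ ⟨l', h.symm⟩).exists_nat_pow_eq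
  have hpow : ∀ (j : ℕ) (x : {y // c y = c l}), (R ^ j) x.1 = ((r (c l) ^ j) x).1 := by
    intro j
    induction j with
    | zero => intro x; rfl
    | succ j ih =>
      intro x
      rw [pow_succ, pow_succ, Equiv.Perm.mul_apply, Equiv.Perm.mul_apply, ← ih]
      exact congrArg _ (h₀ _ x)
  exact ⟨i, by rw [zpow_natCast, hpow i ⟨l, rfl⟩, hi]⟩

/-- The choices in `Cut` can always be made. -/
theorem Cut.nonempty {S : PolygonalSurface} {m : ℕ} (col : S.BoundaryComponent → Fin m) :
    Nonempty (Cut col) := by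
  obtain ⟨r, h1, h2⟩ := exists_rot (legColour col)
  exact ⟨⟨r, h1, h2, Quotient.out, fun i => Quotient.out_eq i⟩⟩

end PolygonalSurface

/-!  Gauss diagrams and their ribbon graphs.  -/

/-- The names of the two families of circles. -/
inductive Family : Type
  | pos
  | neg
  deriving DecidableEq

instance : Fintype Family :=
  ⟨{.pos, .neg}, by rintro (_ | _) <;> decide⟩

/-- The two sides of a coupon that a circle meets when it passes through the coupon. -/
inductive Passage : Type
  | entry
  | exit
  deriving DecidableEq

instance : Fintype Passage :=
  ⟨{.entry, .exit}, by rintro (_ | _) <;> decide⟩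

/-- The four sides of a ribbon, named after the direction of its core. -/
inductive RibbonSide : Type
  | right
  | front
  | left
  | rear
  deriving DecidableEq

instance : Fintype RibbonSide :=
  ⟨{.right, .front, .left, .rear}, by rintro (_ | _ | _ | _) <;> decide⟩

/-- A Gauss diagram: two finite families of oriented circles, and finitely many signed chords, each
with one end on a circle of the first family and one end on a circle of the second.
`next f p` is the chord whose end follows the end of `p` on its circle of the family `f`.
Thus the set of chords on a circle is empty or a single cycle of `next f`. -/
structure GaussDiagram where
  circles : Family → ℕ
  chords : ℕ
  circle : (f : Family) → Fin chords → Fin (circles f)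
  next : Family → Equiv.Perm (Fin chords)
  circle_next : ∀ f p, circle f (next f p) = circle f p
  sameCycle_next : ∀ f p q, circle f p = circle f q → (next f).SameCycle p q
  /-- `true` for a positive chord, `false` for a negative one -/
  sign : Fin chords → Bool

namespace GaussDiagram

variable (G : GaussDiagram)

/-- The circles without chords. -/
abbrev BareCircle : Type := {x : Σ f, Fin (G.circles f) // ∀ p, G.circle x.1 p ≠ x.2}

/-- The ribbons: one for each edge, where `(f, p)` is the edge from the end of the chord `p` to the
end of the chord `next f p`, and one for each circle without chords. -/
abbrev Ribbon : Type := (Family × Fin G.chords) ⊕ G.BareCircle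

/-- The sides of the coupons and ribbons.  The coupon of a chord is a square; `coupon p f e` is the
side by which the circle of the family `f` enters or leaves the coupon of the chord `p`. -/
inductive BandSide : Type
  | coupon (p : Fin G.chords) (f : Family) (e : Passage)
  | ribbon (b : G.Ribbon) (d : RibbonSide)

/-- An enumeration of the sides of coupons and ribbons. -/
def BandSide.equiv :
    G.BandSide ≃ (Fin G.chords × Family × Passage) ⊕ (G.Ribbon × RibbonSide) where
  toFun
    | .coupon p f e => .inl (p, f, e)
    | .ribbon b d => .inr (b, d)
  invFun
    | .inl (p, f, e) => .coupon p f e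
    | .inr (b, d) => .ribbon b d
  left_inv := by rintro (_ | _) <;> rfl
  right_inv := by rintro (_ | _) <;> rfl

noncomputable instance : Fintype G.BandSide :=
  haveI : Finite G.BandSide := Finite.of_equiv _ (BandSide.equiv G).symm
  Fintype.ofFinite _

/-- The counterclockwise order of the sides of the square `[-1,1] × [-1,1]`.  The circle of the
first family goes in the positive `x` direction; the circle of the second family goes in the
positive `y` direction for a positive chord and in the negative `y` direction for
a negative one. -/
def couponNext (positive : Bool) : Equiv.Perm (Family × Passage) where
  toFun
    | (.pos, .exit) => (.neg, if positive then .exit else .entry)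
    | (.neg, .exit) => (.pos, if positive then .entry else .exit)
    | (.pos, .entry) => (.neg, if positive then .entry else .exit)
    | (.neg, .entry) => (.pos, if positive then .exit else .entry)
  invFun
    | (.neg, .exit) => (.pos, if positive then .exit else .entry)
    | (.pos, .entry) => (.neg, if positive then .exit else .entry)
    | (.neg, .entry) => (.pos, if positive then .entry else .exit)
    | (.pos, .exit) => (.neg, if positive then .entry else .exit)
  left_inv := by cases positive <;> decide
  right_inv := by cases positive <;> decide

/-- The counterclockwise order of the sides of a ribbon. -/
def ribbonNext : Equiv.Perm RibbonSide where
  toFun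
    | .right => .front
    | .front => .left
    | .left => .rear
    | .rear => .right
  invFun
    | .front => .right
    | .left => .front
    | .rear => .left
    | .right => .rear
  left_inv := by decide
  right_inv := by decide

/-- The counterclockwise order of the sides of coupons and ribbons. -/
def bandNext : Equiv.Perm G.BandSide where
  toFun
    | .coupon p f e => let x := couponNext (G.sign p) (f, e); .coupon p x.1 x.2
    | .ribbon b d => .ribbon b (ribbonNext d)
  invFun
    | .coupon p f e => let x := (couponNext (G.sign p)).symm (f, e); .coupon p x.1 x.2
    | .ribbon b d => .ribbon b (ribbonNext.symm d)
  left_inv := by rintro (_ | _) <;> simp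
  right_inv := by rintro (_ | _) <;> simp

/-- The ribbon of the edge from `p` to `next f p` is glued by its rear side to the coupon of `p` and
by its front side to the coupon of `next f p`; the ribbon of a circle without chords is
closed up to an annulus.  The right and left sides of all ribbons stay free. -/
def bandGlueFun : G.BandSide → G.BandSide
  | .coupon p f .exit => .ribbon (.inl (f, p)) .rear
  | .coupon p f .entry => .ribbon (.inl (f, (G.next f).symm p)) .front
  | .ribbon (.inl (f, p)) .rear => .coupon p f .exit
  | .ribbon (.inl (f, p)) .front => .coupon (G.next f p) f .entry
  | .ribbon (.inr x) .rear => .ribbon (.inr x) .front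
  | .ribbon (.inr x) .front => .ribbon (.inr x) .rear
  | .ribbon b .right => .ribbon b .right
  | .ribbon b .left => .ribbon b .left

theorem bandGlueFun_involutive : Function.Involutive G.bandGlueFun := by
  rintro (⟨p, f, (_ | _)⟩ | ⟨(⟨f, p⟩ | x), (_ | _ | _ | _)⟩) <;> simp [bandGlueFun]

/-- The ribbon graph associated to a Gauss diagram. -/
noncomputable def ribbonGraph : PolygonalSurface where
  Side := G.BandSide
  next := G.bandNext
  glue := G.bandGlueFun_involutive.toPerm
  glue_glue := G.bandGlueFun_involutive

/-- The cycles of a Gauss diagram. -/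
abbrev Cycle : Type := G.ribbonGraph.BoundaryComponent

end GaussDiagram

/-- A decorated Gauss diagram: a Gauss diagram with a colour assigned to each cycle. -/
structure DecoratedGaussDiagram extends GaussDiagram where
  colours : ℕ
  colour : toGaussDiagram.Cycle → Fin colours

namespace DecoratedGaussDiagram

variable (G : DecoratedGaussDiagram)

/-- The number of cycles. -/
noncomputable def cycles : ℕ := Nat.card G.Cycle

/-- The excess of the colouring. -/
noncomputable def excess : ℤ := (G.cycles : ℤ) - G.colours

/-- The surface associated to a decorated Gauss diagram, for a given way of cutting the spheres
with holes into polygons. -/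
noncomputable def surface (κ : PolygonalSurface.Cut G.colour) : PolygonalSurface :=
  PolygonalSurface.capped κ

end DecoratedGaussDiagram

/-! The Euler characteristic is a count of cells. In the ribbon graph, with h chords, b bare circles
and R = 2h + b ribbons, the vertices are the starting points of the 2R free sides, the edges number
4h + 2R + b and the faces h + R, so χ = -h (`eulerChar_ribbonGraph`). Capping with m colours adds 2m
vertices, one edge for each of the |c| + m legs, and m faces; rim sides merge with existing edges.
This changes χ by 2m - |c| (`eulerChar_capped`), whatever the choices in the cut. All counts come
from explicit bijections: a map constant along `next`, `glue` or the corner relation descends to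
cells, and its inverse names a representative.

For the genus, the cellular complex of a closed connected surface is analysed by ranks. The kernel
of `d₀` is the constants, and the image of `d₁` is the functions on faces with sum zero, because
opposite orientations cancel in pairs (`map_d₁_cochains₁`). Hence the first Betti number is 2 - χ
(`finrank_firstCohomology`).

It remains to see that χ is even (`even_eulerChar`). The vertices of a closed surface are the cycles
of the composite of `glue` and `next`, and the sign of a permutation is determined by the parity of
its number of cycles; multiplicativity of the sign gives the parity of V + E + F. -/

/-! ### Cycles of permutations and their number. -/

namespace Equiv.Perm

/-- The universal property of the orbit quotient. It serves both to define maps on faces and edges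
and to show that two sides lie in the same cell. -/
theorem SameCycle.apply_eq_of_invariant {α β : Type*} {σ : Perm α} {f : α → β}
    (hf : ∀ x, f (σ x) = f x) {x y : α} (h : σ.SameCycle x y) : f x = f y := by
  have key : ∀ (n : ℕ) x, f ((σ ^ n) x) = f x := by
    intro n
    induction n with
    | zero => intro x; rfl
    | succ n ih => intro x; rw [pow_succ', mul_apply, hf, ih]
  obtain ⟨i, rfl⟩ := h
  cases i with
  | ofNat n => simpa using (key n x).symm
  | negSucc n =>
    have := key (n + 1) ((σ ^ (Int.negSucc n)) x)
    rw [zpow_negSucc, ← mul_apply, mul_inv_cancel, one_apply] at this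
    rw [zpow_negSucc]
    exact this

theorem sameCycle_of_involutive {α : Type*} {σ : Perm α} (hσ : ∀ x, σ (σ x) = x) {x y : α}
    (h : σ.SameCycle x y) : y = x ∨ y = σ x := by
  -- Membership in `{x, σ x}` is itself an invariant, with values in `Prop`.
  have := h.apply_eq_of_invariant (f := fun z => (z = x ∨ z = σ x)) (fun z => by
    refine propext ⟨?_, ?_⟩
    · rintro (h | h)
      · exact .inr (by rw [← h, hσ])
      · exact .inl (σ.injective h)
    · rintro (h | h)
      · exact .inr (by rw [h])
      · exact .inl (by rw [h, hσ]))
  exact this ▸ Or.inl rfl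

/-- The classes are the nontrivial cycle factors together with the fixed points, and the sum of the
cycle type is the number of points that are moved. The additive form avoids truncated subtraction.
-/
theorem card_quotient_sameCycle {α : Type*} [Fintype α] [DecidableEq α] (σ : Perm α) :
    Nat.card (Quotient (SameCycle.setoid σ)) + σ.cycleType.sum
      = Fintype.card α + Multiset.card σ.cycleType := by
  have hex : ∀ c : σ.cycleFactorsFinset, ∃ x, x ∈ (c : Perm α).support := fun c =>
    (mem_cycleFactorsFinset_iff.1 c.2).1.nonempty_support
  choose pt hpt using hex
  have hcyc : ∀ c, σ.cycleOf (pt c) = c := fun c =>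
    (cycle_is_cycleOf (hpt c) c.2).symm
  let g : σ.cycleFactorsFinset ⊕ Function.fixedPoints σ → Quotient (SameCycle.setoid σ) :=
    Sum.elim (fun c => Quotient.mk _ (pt c)) (fun x => Quotient.mk _ x.1)
  have hg : Function.Bijective g := by
    constructor
    · have hmix : ∀ c (x : Function.fixedPoints σ), ¬ σ.SameCycle (pt c) x := by
        intro c x h
        have h1 : σ (pt c) = pt c := (Equiv.Perm.SameCycle.apply_eq_self_iff h).2 x.2
        have h2 := mem_cycleFactorsFinset_support_le c.2 (hpt c)
        exact mem_support.1 h2 h1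
      rintro (c | x) (c' | x') h
      · have h' : σ.SameCycle (pt c) (pt c') := Quotient.exact h
        have := h'.cycleOf_eq
        rw [hcyc, hcyc] at this
        rw [Subtype.ext this]
      · exact absurd (Quotient.exact h) (hmix c x')
      · exact absurd (Quotient.exact h.symm) (hmix c' x)
      · have h' : σ.SameCycle x x' := Quotient.exact h
        obtain ⟨i, hi⟩ := h'
        rw [zpow_apply_eq_self_of_apply_eq_self x.2] at hi
        rw [Subtype.ext hi]
    · intro q
      induction q using Quotient.inductionOn with
      | h x =>
        by_cases hx : σ x = x
        · exact ⟨.inr ⟨x, hx⟩, rfl⟩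
        · have hc : σ.cycleOf x ∈ σ.cycleFactorsFinset :=
            cycleOf_mem_cycleFactorsFinset_iff.2 (mem_support.2 hx)
          refine ⟨.inl ⟨_, hc⟩, Quotient.sound ?_⟩
          have := hpt ⟨_, hc⟩
          exact ((mem_support_cycleOf_iff.1 this).1).symm
  have h1 := Nat.card_congr (Equiv.ofBijective g hg)
  rw [← h1, Nat.card_sum, Nat.card_eq_fintype_card, Nat.card_eq_fintype_card, card_fixedPoints,
    cycleType_def, Multiset.card_map, Fintype.card_coe, ← cycleType_def]
  have := sum_cycleType_le σ
  change Finset.card _ + _ + _ = _ + Finset.card _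
  omega

/-- The sign of a permutation in terms of the number of its cycles, fixed points included. -/
theorem sign_eq_neg_one_pow_card_add {α : Type*} [Fintype α] [DecidableEq α] (σ : Perm α) :
    sign σ = (-1) ^ (Fintype.card α + Nat.card (Quotient (SameCycle.setoid σ))) := by
  rw [sign_of_cycleType]
  have h := card_quotient_sameCycle σ
  refine neg_one_pow_congr ?_
  grind

end Equiv.Perm

/-! ### Parity of the Euler characteristic of a closed surface. -/

namespace PolygonalSurface

variable (S : PolygonalSurface)

/-- On a closed surface `glue` is an involution without fixed points, so an edge consists of a
chosen representative and its partner. -/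
theorem card_side_of_isClosed (hS : S.IsClosed) :
    Fintype.card S.Side = 2 * Nat.card S.Edge := by
  let g : S.Edge × Bool → S.Side := fun x => if x.2 then x.1.out else S.glue x.1.out
  have hout : ∀ (e : S.Edge) s, s = e.out ∨ s = S.glue e.out → e = Quotient.mk _ s := by
    rintro e s (rfl | rfl)
    · exact (Quotient.out_eq e).symm
    · refine (Quotient.out_eq e).symm.trans (Quotient.sound ?_)
      exact Equiv.Perm.sameCycle_apply_right.2 (.refl _ _)
  have hg : Function.Bijective g := by
    constructor
    · have hfst : ∀ x, x.1 = Quotient.mk _ (g x) := by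
        rintro ⟨e, (_ | _)⟩
        · exact hout e _ (.inr rfl)
        · exact hout e _ (.inl rfl)
      rintro ⟨e, b⟩ ⟨e', b'⟩ h
      obtain rfl : e = e' := by
        have h1 := hfst (e, b)
        rw [h, ← hfst (e', b')] at h1
        exact h1
      cases b <;> cases b' <;> first | rfl | exact absurd h (hS _) | exact absurd h.symm (hS _)
    · intro s
      have h : S.glue.SameCycle (Quotient.mk _ s : S.Edge).out s :=
        Quotient.exact (Quotient.out_eq (Quotient.mk _ s : S.Edge))
      rcases Equiv.Perm.sameCycle_of_involutive S.glue_glue h with h | h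
      · exact ⟨(Quotient.mk _ s, true), h.symm⟩
      · exact ⟨(Quotient.mk _ s, false), h.symm⟩
  rw [← Nat.card_eq_fintype_card, ← Nat.card_congr (Equiv.ofBijective g hg), Nat.card_prod]
  simp [mul_comm]

/-- Without free sides the corner relation is exactly the graph of `walk`. -/
noncomputable def vertexEquivOfIsClosed (hS : S.IsClosed) :
    S.Vertex ≃ Quotient (Equiv.Perm.SameCycle.setoid S.walk) where
  toFun := Quot.lift (fun s => Quotient.mk _ s) (by
    rintro s _ ⟨-, rfl⟩
    exact Quotient.sound (show S.walk.SameCycle s (S.walk s) from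
      Equiv.Perm.sameCycle_apply_right.2 (.refl _ _)))
  invFun := Quotient.lift S.tail fun _ _ h => h.apply_eq_of_invariant fun s =>
    (Quot.sound ⟨hS s, rfl⟩ : S.tail s = S.tail (S.walk s)).symm
  left_inv := by rintro ⟨s⟩; rfl
  right_inv := by rintro ⟨s⟩; rfl

theorem even_eulerChar (hS : S.IsClosed) : Even S.eulerChar := by
  classical
  have hsign : Equiv.Perm.sign S.walk = Equiv.Perm.sign S.next * Equiv.Perm.sign S.glue :=
    Equiv.Perm.sign_trans _ _
  have hcard := S.card_side_of_isClosed hS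
  rw [Equiv.Perm.sign_eq_neg_one_pow_card_add, Equiv.Perm.sign_eq_neg_one_pow_card_add,
    Equiv.Perm.sign_eq_neg_one_pow_card_add, ← Nat.card_congr (S.vertexEquivOfIsClosed hS),
    -- Multiplying by the sign of `walk` turns that side into a square, hence 1, so the exponent on
    -- the other side is even.
    ← pow_add, ← mul_left_inj ((-1 : ℤˣ) ^ (Fintype.card S.Side + Nat.card S.Vertex)),
    ← pow_add, ← pow_add, Even.neg_one_pow ⟨_, rfl⟩, eq_comm,
    neg_one_pow_eq_one_iff_even (by decide), hcard] at hsign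
  rw [eulerChar]
  obtain ⟨r, hr⟩ := hsign
  -- The even exponent is V + 7E + F, which is χ + 8E.
  refine ⟨r - 4 * Nat.card S.Edge, ?_⟩
  change 2 * Nat.card S.Edge + Nat.card S.Face + (2 * Nat.card S.Edge + Nat.card S.Edge) +
    (2 * Nat.card S.Edge + Nat.card S.Vertex) = r + r at hr
  omega

end PolygonalSurface

/-! ### Cells of the capped surface. -/

namespace PolygonalSurface

section Capping

variable {S : PolygonalSurface} {m : ℕ} {col : S.BoundaryComponent → Fin m} (κ : Cut col)

theorem face_next (S : PolygonalSurface) (s : S.Side) :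
    (Quotient.mk _ (S.next s) : S.Face) = Quotient.mk _ s :=
  Quotient.sound (show S.next.SameCycle (S.next s) s from
    Equiv.Perm.sameCycle_apply_left.2 (.refl _ _))

theorem edge_glue (S : PolygonalSurface) (s : S.Side) :
    (Quotient.mk _ (S.glue s) : S.Edge) = Quotient.mk _ s :=
  Quotient.sound (show S.glue.SameCycle (S.glue s) s from
    Equiv.Perm.sameCycle_apply_left.2 (.refl _ _))

theorem tail_next_glue (S : PolygonalSurface) (s : S.Side) (hs : ¬ S.IsFree s) :
    S.tail (S.next (S.glue s)) = S.tail s :=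
  S.head_glue s hs

theorem isClosed_capped : (capped κ).IsClosed := by
  intro s h
  change capGlueFun s = s at h
  rcases s with s | s | l | l
  · by_cases hs : S.IsFree s
    · simp [capGlueFun, hs] at h
    · rw [capGlueFun, dif_neg hs] at h
      exact hs (Sum.inl_injective h)
  all_goals simp [capGlueFun] at h

theorem capped_glue_of_isFree {s : S.Side} (hs : S.IsFree s) :
    (capped κ).glue (.inl s) = .inr (.rim ⟨s, hs⟩) :=
  dif_pos hs

theorem capped_glue_of_not_isFree {s : S.Side} (hs : ¬ S.IsFree s) :
    (capped κ).glue (.inl s) = .inl (S.glue s) :=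
  dif_neg hs

/-- The first step of the walk from a free side reaches its head; every later step rotates about
that vertex. -/
theorem tail_nextFree (s : S.Free) : S.tail (S.nextFree s).1 = S.head s.1 := by
  classical
  have key : ∀ k, k ≤ Nat.find (S.exists_return s) →
      S.tail ((S.walk ^ (k + 1)) s.1) = S.head s.1 := by
    intro k
    induction k with
    | zero =>
      intro _
      rw [zero_add, pow_one]
      change S.tail (S.next (S.glue s.1)) = _
      rw [show S.glue s.1 = s.1 from s.2]
      rfl
    | succ k ih =>
      intro hk
      rw [pow_succ', Equiv.Perm.mul_apply]
      -- Before the first return the sides met are glued, so the rotation keeps the vertex.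
      exact (S.tail_next_glue _ (Nat.find_min (S.exists_return s) (by omega))).trans
        (ih (by omega))
  have h : (S.nextFree s).1 = (S.walk ^ (Nat.find (S.exists_return s) + 1)) s.1 := rfl
  rw [h]
  exact key _ le_rfl

theorem component_nextFree (s : S.Free) : S.component (S.nextFree s) = S.component s :=
  Quotient.sound (show S.nextFree.SameCycle (S.nextFree s) s from
    Equiv.Perm.sameCycle_apply_left.2 (.refl _ _))

theorem component_nextFree_symm (s : S.Free) :
    S.component (S.nextFree.symm s) = S.component s := by
  conv_rhs => rw [← S.nextFree.apply_symm_apply s]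
  rw [component_nextFree]

/-- The edge that contains a side of the capped surface: an edge of the given surface or a leg. -/
def capEdge : S.Side ⊕ CapSide S m → S.Edge ⊕ (S.BoundaryComponent ⊕ Fin m)
  | .inl s => .inl (Quotient.mk _ s)
  | .inr (.rim s) => .inl (Quotient.mk _ s.1)
  | .inr (.out l) => .inr l
  | .inr (.back l) => .inr l

theorem capEdge_glue (s : S.Side ⊕ CapSide S m) :
    capEdge ((capped κ).glue s) = capEdge s := by
  rcases s with s | s | l | l
  · by_cases hs : S.IsFree s
    · rw [capped_glue_of_isFree κ hs, capEdge, capEdge]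
    · rw [capped_glue_of_not_isFree κ hs]
      exact congrArg Sum.inl (edge_glue S s)
  all_goals rfl

/-- The edges of the capped surface: those of the given surface, and the legs. -/
noncomputable def edgeCappedEquiv :
    (capped κ).Edge ≃ S.Edge ⊕ (S.BoundaryComponent ⊕ Fin m) where
  toFun := Quotient.lift capEdge fun _ _ h =>
    Equiv.Perm.SameCycle.apply_eq_of_invariant (capEdge_glue κ) h
  invFun := Sum.elim (Quotient.lift (fun s => (Quotient.mk _ (.inl s) : (capped κ).Edge))
    fun _ _ h => Equiv.Perm.SameCycle.apply_eq_of_invariant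
      (f := fun s => (Quotient.mk _ (.inl s) : (capped κ).Edge)) (fun s => by
        by_cases hs : S.IsFree s
        · rw [show S.glue s = s from hs]
        · have h := edge_glue (capped κ) (.inl s)
          rwa [capped_glue_of_not_isFree κ hs] at h) h)
    (fun l => (Quotient.mk _ (.inr (.out l)) : (capped κ).Edge))
  left_inv := by
    rintro ⟨s | s | l | l⟩
    · rfl
    · exact edge_glue (capped κ) (.inr (.rim s))
    · rfl
    · exact edge_glue (capped κ) (.inr (.back l))
  right_inv := by
    rintro (s | l)
    · exact Quotient.inductionOn s fun _ => rfl
    · rfl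

open Classical in
theorem Cut.capNext_rim_nextFree (t : S.Free) :
    κ.capNext (.rim (S.nextFree t)) =
      if κ.base (S.component t) = t then .back (.inl (S.component t)) else .rim t := by
  simp [Cut.capNext]

open Classical in
-- A hole is run through backwards from its base side, so every rim side is reached from the base by
-- iterating `nextFree.symm`, and the base follows the outgoing leg.
theorem face_rim (s : S.Free) :
    (Quotient.mk _ (.inr (.rim s)) : (capped κ).Face)
      = Quotient.mk _ (.inr (.out (.inl (S.component s)))) := by
  have hout : ∀ i, (Quotient.mk _ (.inr (.rim (κ.base i))) : (capped κ).Face)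
      = Quotient.mk _ (.inr (.out (.inl i))) := fun i =>
    face_next (capped κ) (.inr (.out (.inl i)))
  have hpow : ∀ (n : ℕ) i, (Quotient.mk _ (.inr (.rim ((S.nextFree.symm ^ n) (κ.base i)))) :
      (capped κ).Face) = Quotient.mk _ (.inr (.rim (κ.base i))) ∧
        S.component ((S.nextFree.symm ^ n) (κ.base i)) = i := by
    intro n i
    induction n with
    | zero => exact ⟨rfl, κ.component_base i⟩
    | succ n ih =>
      rw [pow_succ', Equiv.Perm.mul_apply]
      set u := (S.nextFree.symm ^ n) (κ.base i)
      have hc : S.component (S.nextFree.symm u) = i := by rw [component_nextFree_symm, ih.2]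
      refine ⟨?_, hc⟩
      -- If the tour has closed up, the new rim side is the base again and nothing is to be shown;
      -- otherwise it is the successor of `rim u` in the polygon.
      by_cases hb : κ.base (S.component (S.nextFree.symm u)) = S.nextFree.symm u
      · rw [← hb, hc]
      · refine Eq.trans ?_ ((face_next (capped κ) (.inr (.rim u))).trans ih.1)
        refine congrArg (Quotient.mk _) ?_
        change _ = Sum.inr (κ.capNext (.rim u))
        refine congrArg Sum.inr ?_
        change _ = ite _ _ _
        rw [if_neg hb]
  have hs : S.nextFree.SameCycle s (κ.base (S.component s)) :=
    Quotient.exact (κ.component_base (S.component s)).symm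
  obtain ⟨n, hn⟩ := hs.exists_nat_pow_eq
  have : s = (S.nextFree.symm ^ n) (κ.base (S.component s)) := by
    rw [← hn]
    change s = (S.nextFree⁻¹ ^ n) _
    rw [inv_pow, ← Equiv.Perm.mul_apply, inv_mul_cancel, Equiv.Perm.one_apply]
  have h := (hpow n (S.component s)).1.trans (hout _)
  rwa [← this] at h

/-- A returning leg follows the last rim side of its hole, which is `nextFree` of the base; at a
plain point it directly follows the outgoing leg. -/
theorem face_back (l : S.BoundaryComponent ⊕ Fin m) :
    (Quotient.mk _ (.inr (.back l)) : (capped κ).Face) = Quotient.mk _ (.inr (.out l)) := by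
  rcases l with i | k
  · have h1 := face_next (capped κ) (.inr (.rim (S.nextFree (κ.base i))))
    have h2 : (capped κ).next (.inr (.rim (S.nextFree (κ.base i)))) = .inr (.back (.inl i)) := by
      change Sum.inr (κ.capNext _) = _
      simp [Cut.capNext, κ.component_base]
    rw [h2, face_rim, component_nextFree, κ.component_base] at h1
    exact h1
  · exact face_next (capped κ) (.inr (.out (.inr k)))

theorem face_out (l l' : S.BoundaryComponent ⊕ Fin m) (h : legColour col l = legColour col l') :
    (Quotient.mk _ (.inr (.out l)) : (capped κ).Face) = Quotient.mk _ (.inr (.out l')) :=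
  (κ.sameCycle_rot l l' h).apply_eq_of_invariant
    (f := fun l => (Quotient.mk _ (.inr (.out l)) : (capped κ).Face)) fun l =>
      (face_next (capped κ) (.inr (.back l))).trans (face_back κ l)

variable (col) in
/-- The face that contains a side of the capped surface: a face of the given surface or a colour. -/
noncomputable def capFace : S.Side ⊕ CapSide S m → S.Face ⊕ Fin m
  | .inl s => .inl (Quotient.mk _ s)
  | .inr (.rim s) => .inr (col (S.component s))
  | .inr (.out l) => .inr (legColour col l)
  | .inr (.back l) => .inr (legColour col l)

theorem capFace_next (s : S.Side ⊕ CapSide S m) :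
    capFace col ((capped κ).next s) = capFace col s := by
  rcases s with s | s | (i | k) | l
  · exact congrArg Sum.inl (face_next S s)
  · obtain ⟨t, rfl⟩ := S.nextFree.surjective s
    change capFace col (.inr (κ.capNext (.rim (S.nextFree t)))) = _
    rw [κ.capNext_rim_nextFree, capFace, component_nextFree]
    split_ifs <;> rfl
  · exact congrArg Sum.inr (congrArg col (κ.component_base i))
  · rfl
  · exact congrArg Sum.inr (κ.legColour_rot l)

/-- The faces of the capped surface: those of the given surface, and one for each colour. -/
noncomputable def faceCappedEquiv : (capped κ).Face ≃ S.Face ⊕ Fin m where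
  toFun := Quotient.lift (capFace col) fun _ _ h =>
    Equiv.Perm.SameCycle.apply_eq_of_invariant (capFace_next κ) h
  invFun := Sum.elim (Quotient.lift (fun s => (Quotient.mk _ (.inl s) : (capped κ).Face))
    fun _ _ h => Equiv.Perm.SameCycle.apply_eq_of_invariant
      (f := fun s => (Quotient.mk _ (.inl s) : (capped κ).Face))
      (fun s => face_next (capped κ) (.inl s)) h)
    (fun k => (Quotient.mk _ (.inr (.out (.inr k))) : (capped κ).Face))
  left_inv := by
    rintro ⟨s | s | l | l⟩
    · rfl
    · exact (face_out κ (.inr (col (S.component s))) (.inl (S.component s)) rfl).trans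
        (face_rim κ s).symm
    · exact face_out κ (.inr (legColour col l)) l rfl
    · exact (face_out κ (.inr (legColour col l)) l rfl).trans (face_back κ l).symm
  right_inv := by
    rintro (s | k)
    · exact Quotient.inductionOn s fun _ => rfl
    · rfl

/-- The vertex at which a side of the capped surface starts: a vertex of the given surface, the
centre of a colour, or the point of a colour. -/
def Cut.capTail : S.Side ⊕ CapSide S m → S.Vertex ⊕ (Fin m ⊕ Fin m)
  | .inl s => .inl (S.tail s)
  | .inr (.rim s) => .inl (S.head s.1)
  | .inr (.out l) => .inr (.inl (legColour col l))
  | .inr (.back (.inl i)) => .inl (S.head (κ.base i).1)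
  | .inr (.back (.inr k)) => .inr (.inr k)

/-- The substantial case is a free side: rotating about its tail leads into the cap, to the
preceding rim side or to the leg attached at that point. -/
theorem capTail_next_glue (s : S.Side ⊕ CapSide S m) :
    κ.capTail ((capped κ).next ((capped κ).glue s)) = κ.capTail s := by
  rcases s with s | s | l | (i | k)
  · by_cases hs : S.IsFree s
    -- With `t` the preceding boundary side, both possible landing sides start at the head of `t`,
    -- which is the tail of `s`.
    · obtain ⟨t, ht⟩ := S.nextFree.surjective ⟨s, hs⟩
      have hts : S.tail s = S.head t.1 := by rw [← tail_nextFree, ht]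
      rw [capped_glue_of_isFree κ hs, ← ht]
      change κ.capTail (.inr (κ.capNext (.rim (S.nextFree t)))) = .inl (S.tail s)
      rw [κ.capNext_rim_nextFree, hts]
      split_ifs with hb
      · exact congrArg Sum.inl (by rw [hb])
      · rfl
    · rw [capped_glue_of_not_isFree κ hs]
      exact congrArg Sum.inl (S.tail_next_glue s hs)
  · rfl
  · exact congrArg (fun k => Sum.inr (Sum.inl k)) (κ.legColour_rot l)
  · rfl
  · rfl

/-- The vertices of the capped surface: those of the given surface, and for each colour the centre
and the end of the leg that goes to a point. -/
noncomputable def vertexCappedEquiv : (capped κ).Vertex ≃ S.Vertex ⊕ (Fin m ⊕ Fin m) where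
  toFun := Quot.lift κ.capTail <| by
    rintro s _ ⟨-, rfl⟩
    exact (capTail_next_glue κ s).symm
  invFun := Sum.elim (Quot.lift (fun s => (capped κ).tail (.inl s)) (by
      rintro s _ ⟨hs, rfl⟩
      have h := tail_next_glue (capped κ) (.inl s) (isClosed_capped κ _)
      rw [capped_glue_of_not_isFree κ hs] at h
      exact h.symm))
    (Sum.elim (fun k => (capped κ).tail (.inr (.out (.inr k))))
      (fun k => (capped κ).tail (.inr (.back (.inr k)))))
  left_inv := by
    have hrim : ∀ s, (capped κ).tail (.inr (.rim s)) = (capped κ).tail (.inl (S.next s.1)) :=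
      fun s => (tail_next_glue (capped κ) (.inr (.rim s)) (isClosed_capped κ _)).symm
    rintro ⟨s | s | l | (i | k)⟩
    · rfl
    · exact (hrim s).symm
    -- Rotating about the centre passes from leg to leg by `rot`, which is transitive on each
    -- colour.
    · exact (κ.sameCycle_rot (.inr (legColour col l)) l rfl).apply_eq_of_invariant
        (f := fun l => (capped κ).tail (.inr (.out l))) fun l =>
          tail_next_glue (capped κ) (.inr (.out l)) (isClosed_capped κ _)
    -- The leg to a hole ends where the base rim side starts.
    · exact (hrim _).symm.trans
        (tail_next_glue (capped κ) (.inr (.back (.inl i))) (isClosed_capped κ _))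
    · rfl
  right_inv := by
    rintro (s | k | k)
    · exact Quot.inductionOn s fun _ => rfl
    · rfl
    · rfl

instance (S : PolygonalSurface) : Finite S.Vertex := Quot.finite _

theorem eulerChar_capped :
    (capped κ).eulerChar = S.eulerChar + 2 * m - Nat.card S.BoundaryComponent := by
  simp only [eulerChar, Nat.card_congr (vertexCappedEquiv κ), Nat.card_congr (edgeCappedEquiv κ),
    Nat.card_congr (faceCappedEquiv κ), Nat.card_sum, Nat.card_fin]
  push_cast
  ring

end Capping

end PolygonalSurface

/-! ### Cells of the ribbon graph. -/

namespace GaussDiagram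

open PolygonalSurface

variable (G : GaussDiagram)

/-- For either sign the four sides form a single 4-cycle; bounding the exponent by `Fin 4` makes
this decidable. -/
theorem exists_couponNext_pow_eq : ∀ (b : Bool) (x y : Family × Passage),
    ∃ i : Fin 4, (couponNext b ^ (i : ℕ)) x = y := by
  decide

theorem exists_ribbonNext_pow_eq : ∀ x y : RibbonSide, ∃ i : Fin 4, (ribbonNext ^ (i : ℕ)) x = y := by
  decide

/-- The coupon or ribbon that contains a side. -/
def sideFace : G.BandSide → Fin G.chords ⊕ G.Ribbon
  | .coupon p _ _ => .inl p
  | .ribbon b _ => .inr b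

theorem face_coupon (p : Fin G.chords) (x y : Family × Passage) :
    (Quotient.mk _ (.coupon p x.1 x.2) : G.ribbonGraph.Face)
      = Quotient.mk _ (.coupon p y.1 y.2) := by
  obtain ⟨i, hi⟩ := exists_couponNext_pow_eq (G.sign p) x y
  exact Equiv.Perm.SameCycle.apply_eq_of_invariant (σ := couponNext (G.sign p))
    (f := fun x => (Quotient.mk _ (.coupon p x.1 x.2) : G.ribbonGraph.Face))
    (fun x => face_next G.ribbonGraph (.coupon p x.1 x.2)) ⟨i, by rw [zpow_natCast, hi]⟩

theorem face_ribbon (b : G.Ribbon) (x y : RibbonSide) :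
    (Quotient.mk _ (.ribbon b x) : G.ribbonGraph.Face) = Quotient.mk _ (.ribbon b y) := by
  obtain ⟨i, hi⟩ := exists_ribbonNext_pow_eq x y
  exact Equiv.Perm.SameCycle.apply_eq_of_invariant (σ := ribbonNext)
    (f := fun x => (Quotient.mk _ (.ribbon b x) : G.ribbonGraph.Face))
    (fun x => face_next G.ribbonGraph (.ribbon b x)) ⟨i, by rw [zpow_natCast, hi]⟩

/-- The faces of the ribbon graph are the coupons and the ribbons. -/
noncomputable def faceEquiv : G.ribbonGraph.Face ≃ Fin G.chords ⊕ G.Ribbon where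
  toFun := Quotient.lift G.sideFace fun _ _ h =>
    Equiv.Perm.SameCycle.apply_eq_of_invariant (by rintro (_ | _) <;> rfl) h
  invFun := Sum.elim (fun p => (Quotient.mk _ (.coupon p .pos .entry) : G.ribbonGraph.Face))
    (fun b => (Quotient.mk _ (.ribbon b .right) : G.ribbonGraph.Face))
  left_inv := by
    rintro ⟨⟨p, f, e⟩ | ⟨b, d⟩⟩
    · exact G.face_coupon p (.pos, .entry) (f, e)
    · exact G.face_ribbon b .right d
  right_inv := by rintro (_ | _) <;> rfl

/-- The edge that contains a side: a side of a coupon, a free side of a ribbon (the right or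
the left one), or the seam of an annulus. -/
def sideEdge : G.BandSide →
    (Fin G.chords × Family × Passage) ⊕ ((G.Ribbon × Bool) ⊕ G.BareCircle)
  | .coupon p f e => .inl (p, f, e)
  | .ribbon (.inl (f, p)) .rear => .inl (p, f, .exit)
  | .ribbon (.inl (f, p)) .front => .inl (G.next f p, f, .entry)
  | .ribbon (.inr x) .rear => .inr (.inr x)
  | .ribbon (.inr x) .front => .inr (.inr x)
  | .ribbon b .right => .inr (.inl (b, true))
  | .ribbon b .left => .inr (.inl (b, false))

theorem sideEdge_glue (s : G.BandSide) : G.sideEdge (G.bandGlueFun s) = G.sideEdge s := by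
  rcases s with ⟨p, f, (_ | _)⟩ | ⟨(⟨f, p⟩ | x), (_ | _ | _ | _)⟩ <;>
    simp [bandGlueFun, sideEdge]

/-- The edges of the ribbon graph. -/
noncomputable def edgeEquiv : G.ribbonGraph.Edge ≃
    (Fin G.chords × Family × Passage) ⊕ ((G.Ribbon × Bool) ⊕ G.BareCircle) where
  toFun := Quotient.lift G.sideEdge fun _ _ h =>
    Equiv.Perm.SameCycle.apply_eq_of_invariant G.sideEdge_glue h
  invFun := Sum.elim (fun x => (Quotient.mk _ (.coupon x.1 x.2.1 x.2.2) : G.ribbonGraph.Edge))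
    (Sum.elim (fun x => (Quotient.mk _ (.ribbon x.1 (if x.2 then .right else .left)) :
      G.ribbonGraph.Edge))
      (fun x => (Quotient.mk _ (.ribbon (.inr x) .rear) : G.ribbonGraph.Edge)))
  left_inv := by
    rintro ⟨⟨p, f, e⟩ | ⟨(⟨f, p⟩ | x), (_ | _ | _ | _)⟩⟩
    · rfl
    · rfl
    · exact edge_glue G.ribbonGraph (.ribbon (.inl (f, p)) .front)
    · rfl
    · exact edge_glue G.ribbonGraph (.ribbon (.inl (f, p)) .rear)
    · rfl
    · exact edge_glue G.ribbonGraph (.ribbon (.inr x) .front)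
    · rfl
    · rfl
  right_inv := by rintro (_ | ⟨(_ | _), (_ | _)⟩ | _) <;> rfl

/-- The free side of a ribbon that starts at the same point as a side of a coupon. -/
def couponTail (p : Fin G.chords) : Family × Passage → G.Ribbon × Bool
  | (f, .exit) => (.inl (f, p), true)
  | (f, .entry) => (.inl (f, (G.next f).symm p), false)

/-- The free side of a ribbon that starts at the same point as a given side. -/
def sideTail : G.BandSide → G.Ribbon × Bool
  | .coupon p f e => G.couponTail p (f, e)
  | .ribbon (.inl (f, p)) .rear => G.couponTail p (couponNext (G.sign p) (f, .exit))
  | .ribbon (.inl (f, p)) .front =>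
      G.couponTail (G.next f p) (couponNext (G.sign (G.next f p)) (f, .entry))
  | .ribbon (.inr x) .rear => (.inr x, false)
  | .ribbon (.inr x) .front => (.inr x, true)
  | .ribbon b .right => (b, true)
  | .ribbon b .left => (b, false)

/-- The vertices of the ribbon graph are the starting points of the free sides. -/
noncomputable def vertexEquiv : G.ribbonGraph.Vertex ≃ G.Ribbon × Bool where
  toFun := Quot.lift G.sideTail <| by
    rintro (⟨p, f, (_ | _)⟩ | ⟨(⟨f, p⟩ | x), (_ | _ | _ | _)⟩) _ ⟨h, rfl⟩ <;>
      first | rfl | exact absurd rfl h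
  invFun x := G.ribbonGraph.tail (.ribbon x.1 (if x.2 then .right else .left))
  left_inv := by
    -- One rotation about the tail of a coupon side lands on a free side of the adjacent ribbon.
    -- From a glued end of an open ribbon, one rotation leads to a coupon side, and this fact
    -- finishes.
    have hc : ∀ (p : Fin G.chords) (x : Family × Passage),
        G.ribbonGraph.tail (.ribbon (G.couponTail p x).1
          (if (G.couponTail p x).2 then .right else .left))
            = G.ribbonGraph.tail (.coupon p x.1 x.2) := by
      rintro p ⟨f, (_ | _)⟩
      · exact tail_next_glue G.ribbonGraph (.coupon p f .entry) nofun
      · exact tail_next_glue G.ribbonGraph (.coupon p f .exit) nofun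
    rintro ⟨⟨p, f, e⟩ | ⟨(⟨f, p⟩ | x), (_ | _ | _ | _)⟩⟩
    · exact hc p (f, e)
    · rfl
    · exact (hc _ _).trans (tail_next_glue G.ribbonGraph (.ribbon (.inl (f, p)) .front) nofun)
    · rfl
    · exact (hc _ _).trans (tail_next_glue G.ribbonGraph (.ribbon (.inl (f, p)) .rear) nofun)
    · rfl
    · exact tail_next_glue G.ribbonGraph (.ribbon (.inr x) .front) nofun
    · rfl
    · exact tail_next_glue G.ribbonGraph (.ribbon (.inr x) .rear) nofun
  right_inv := by rintro ⟨(_ | _), (_ | _)⟩ <;> rfl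

theorem eulerChar_ribbonGraph : G.ribbonGraph.eulerChar = -G.chords := by
  have hf : Nat.card Family = 2 := by rw [Nat.card_eq_fintype_card]; rfl
  have hp : Nat.card Passage = 2 := by rw [Nat.card_eq_fintype_card]; rfl
  simp only [eulerChar, Nat.card_congr G.vertexEquiv, Nat.card_congr G.edgeEquiv,
    Nat.card_congr G.faceEquiv, Nat.card_sum, Nat.card_prod, Nat.card_fin, hf, hp,
    Nat.card_eq_fintype_card (α := Bool), Fintype.card_bool]
  push_cast
  ring

end GaussDiagram

/-! ### Rational cohomology of a closed connected surface. -/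

namespace PolygonalSurface

variable (S : PolygonalSurface)

/-- Such a function descends to a locally constant function on the realization. This translates
topological connectedness into combinatorics. -/
theorem eq_of_connectedSpace [ConnectedSpace S.Realization] {β : Type*} (f : S.Side → β)
    (hnext : ∀ s, f (S.next s) = f s) (hglue : ∀ s, f (S.glue s) = f s) (s t : S.Side) :
    f s = f t := by
  let : TopologicalSpace β := ⊥
  have : DiscreteTopology β := ⟨rfl⟩
  let F : S.Realization → β := Quot.lift (fun x => f x.1) (by
    rintro _ _ (_ | _ | _)
    · rfl
    · exact (hnext _).symm
    · exact (hglue _).symm)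
  have hF : Continuous F :=
    continuous_quot_lift _ (continuous_sigma fun t => (continuous_const : Continuous fun _ => f t))
  exact PreconnectedSpace.constant inferInstance hF
    (x := Quot.mk _ ⟨s, (0, 0)⟩) (y := Quot.mk _ ⟨t, (0, 0)⟩)

theorem nonempty_side [ConnectedSpace S.Realization] : Nonempty S.Side := by
  obtain ⟨⟨x⟩⟩ := (inferInstance : Nonempty S.Realization)
  exact ⟨x.1⟩

/-- A cochain is determined freely by its values on one chosen side of each edge, the other side
carrying the opposite value. -/
theorem finrank_cochains₁ (hS : S.IsClosed) :
    Module.finrank ℚ S.cochains₁ = Nat.card S.Edge := by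
  classical
  have hcases : ∀ s : S.Side, s = (Quotient.mk _ s : S.Edge).out ∨
      s = S.glue (Quotient.mk _ s : S.Edge).out := fun s =>
    Equiv.Perm.sameCycle_of_involutive S.glue_glue
      (Quotient.exact (Quotient.out_eq (Quotient.mk _ s : S.Edge)))
  let φ : S.cochains₁ →ₗ[ℚ] (S.Edge → ℚ) :=
    { toFun := fun f e => f.1 e.out
      map_add' := fun _ _ => rfl
      map_smul' := fun _ _ => rfl }
  have hφ : Function.Bijective φ := by
    constructor
    · intro f g h
      refine Subtype.ext (funext fun s => ?_)
      have he : f.1 (Quotient.mk _ s : S.Edge).out = g.1 (Quotient.mk _ s : S.Edge).out :=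
        congrFun h _
      rcases hcases s with hs | hs <;> rw [hs]
      · exact he
      · rw [f.2 _ (hS _), g.2 _ (hS _), he]
    · intro g
      refine ⟨⟨fun s => if s = (Quotient.mk _ s : S.Edge).out then g (Quotient.mk _ s)
        else -g (Quotient.mk _ s), ?_⟩, funext fun e => ?_⟩
      · intro s hs
        change ite _ _ _ = -ite _ _ _
        rw [edge_glue]
        rcases hcases s with h | h
        · rw [if_pos h, if_neg fun h' => hs (h'.trans h.symm)]
        · have h' : S.glue s = (Quotient.mk _ s : S.Edge).out := by
            conv_lhs => rw [h]
            exact S.glue_glue _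
          rw [if_pos h', if_neg fun h'' => hs (h'.trans h''.symm), neg_neg]
      · change ite _ _ _ = _
        rw [Quotient.out_eq, if_pos rfl]
  rw [(LinearEquiv.ofBijective φ hφ).finrank_eq, Module.finrank_fintype_fun_eq_card,
    Nat.card_eq_fintype_card]

theorem finrank_coboundaries [ConnectedSpace S.Realization] :
    Module.finrank ℚ S.coboundaries + 1 = Nat.card S.Vertex := by
  classical
  have : Fintype S.Vertex := Fintype.ofFinite _
  have hker : LinearMap.ker S.d₀ = Submodule.span ℚ {fun _ => 1} := by
    refine le_antisymm ?_ ?_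
    · intro f hf
      have hf' : ∀ s, f (S.head s) = f (S.tail s) := fun s => sub_eq_zero.1 (congrFun hf s)
      obtain ⟨s₀⟩ := S.nonempty_side
      refine Submodule.mem_span_singleton.2 ⟨f (S.tail s₀), funext fun v => ?_⟩
      induction v using Quot.inductionOn with
      | h s =>
        -- Invariance under `next` is `hf'` itself, since the head of a side is by definition the
        -- tail of the next one.
        have := S.eq_of_connectedSpace (fun s => f (S.tail s)) hf' (fun s => by
          by_cases hs : S.IsFree s
          · rw [show S.glue s = s from hs]
          · rw [S.tail_glue s hs, hf']) s₀ s
        exact (mul_one _).trans this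
    · rw [Submodule.span_singleton_le_iff_mem]
      ext s
      exact sub_self _
  obtain ⟨s₀⟩ := S.nonempty_side
  have h1 : Module.finrank ℚ (LinearMap.ker S.d₀) = 1 := by
    rw [hker]
    exact finrank_span_singleton fun h => one_ne_zero (congrFun h (S.tail s₀))
  have := LinearMap.finrank_range_add_finrank_ker S.d₀
  rw [h1, Module.finrank_fintype_fun_eq_card, ← Nat.card_eq_fintype_card] at this
  exact this

theorem d₁_single [DecidableEq S.Side] [DecidableEq S.Face] (s : S.Side) :
    S.d₁ (Pi.single s 1) = Pi.single (Quotient.mk _ s) 1 := by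
  ext F
  simp only [d₁, LinearMap.coe_mk, AddHom.coe_mk]
  rw [Finset.sum_eq_single s]
  · simp [Pi.single_apply, eq_comm]
  · intro t _ ht
    simp [ht]
  · simp

theorem sum_d₁ [Fintype S.Face] (f : S.Side → ℚ) : ∑ F, S.d₁ f F = ∑ s, f s := by
  classical
  change ∑ F, ∑ s, ite _ _ _ = _
  rw [Finset.sum_comm]
  simp

/-- Reindexing by `glue` shows that the total sum of a cochain is its own negative; here the
orientation enters. Conversely, differences of indicators of faces span the functions with sum zero,
and connectedness reduces them to faces adjacent along an edge. -/
theorem map_d₁_cochains₁ [ConnectedSpace S.Realization] [Fintype S.Face] (hS : S.IsClosed) :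
    S.cochains₁.map S.d₁
      = LinearMap.ker (∑ F, LinearMap.proj F : (S.Face → ℚ) →ₗ[ℚ] ℚ) := by
  classical
  refine le_antisymm ?_ fun g hg => ?_
  · rintro _ ⟨f, hf, rfl⟩
    rw [LinearMap.mem_ker]
    simp only [LinearMap.sum_apply, LinearMap.proj_apply, sum_d₁]
    have h1 : ∑ s, f (S.glue s) = ∑ s, f s := Equiv.sum_comp S.glue f
    rw [Finset.sum_congr rfl fun s _ => hf s (hS s), Finset.sum_neg_distrib] at h1
    linarith
  · obtain ⟨s₀⟩ := S.nonempty_side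
    let R := S.cochains₁.map S.d₁
    let δ : S.Face → S.Face → ℚ := fun F => Pi.single F 1
    have hδ : ∀ s, δ (Quotient.mk _ s) - δ (Quotient.mk _ s₀) ∈ R := by
      have hstep : ∀ s, δ (Quotient.mk _ s) - δ (Quotient.mk _ (S.glue s)) ∈ R := by
        intro s
        -- The cochain dual to the edge of `s` has as coboundary the difference of the faces on its
        -- two sides.
        refine ⟨Pi.single s 1 - Pi.single (S.glue s) 1, ?_, ?_⟩
        · intro t _
          have h1 : S.glue t = s ↔ t = S.glue s :=
            ⟨fun h => by rw [← h, S.glue_glue], fun h => by rw [h, S.glue_glue]⟩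
          simp only [Pi.sub_apply, Pi.single_apply, S.glue.injective.eq_iff, h1]
          ring
        · rw [map_sub, d₁_single, d₁_single]
      have := S.eq_of_connectedSpace
        (fun s => δ (Quotient.mk _ s) - δ (Quotient.mk _ s₀) ∈ R)
        (fun s => by rw [face_next]) (fun s => propext ⟨fun h => ?_, fun h => ?_⟩)
      · intro s
        rw [this s s₀, sub_self]
        exact R.zero_mem
      · simpa using R.add_mem (hstep s) h
      · simpa using R.sub_mem h (hstep s)
    have hsum : ∑ F, g F = 0 := by simpa using hg
    -- The terms at the base face cancel because the values of `g` sum to zero.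
    have hg' : g = ∑ F, g F • (δ F - δ (Quotient.mk _ s₀)) := by
      simp only [smul_sub, Finset.sum_sub_distrib, ← Finset.sum_smul, hsum, zero_smul, sub_zero]
      ext F
      simp [δ, Pi.single_apply]
    rw [hg']
    exact R.sum_mem fun F _ => R.smul_mem _ (Quotient.inductionOn F hδ)

/-- Rank-nullity for `d₁` on cochains: the domain has dimension E and the image F - 1. -/
theorem finrank_cocycles [ConnectedSpace S.Realization] (hS : S.IsClosed) :
    Module.finrank ℚ S.cocycles + Nat.card S.Face = Nat.card S.Edge + 1 := by
  classical
  let D := S.d₁.comp S.cochains₁.subtype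
  have hker : Module.finrank ℚ (LinearMap.ker D) = Module.finrank ℚ S.cocycles := by
    rw [LinearMap.ker_comp, ← Submodule.finrank_map_subtype_eq, Submodule.map_comap_subtype]
    rfl
  have hrange : LinearMap.range D
      = LinearMap.ker (∑ F, LinearMap.proj F : (S.Face → ℚ) →ₗ[ℚ] ℚ) := by
    rw [← S.map_d₁_cochains₁ hS, LinearMap.range_comp, Submodule.range_subtype]
  obtain ⟨s₀⟩ := S.nonempty_side
  have hsurj : LinearMap.range (∑ F, LinearMap.proj F : (S.Face → ℚ) →ₗ[ℚ] ℚ) = ⊤ := by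
    refine LinearMap.range_eq_top.2 fun a => ⟨Pi.single (Quotient.mk _ s₀) a, ?_⟩
    simp
  have h1 := LinearMap.finrank_range_add_finrank_ker
    (∑ F, LinearMap.proj F : (S.Face → ℚ) →ₗ[ℚ] ℚ)
  have h2 := LinearMap.finrank_range_add_finrank_ker D
  rw [hsurj, finrank_top, Module.finrank_self, Module.finrank_fintype_fun_eq_card] at h1
  rw [hrange, hker, S.finrank_cochains₁ hS] at h2
  rw [Nat.card_eq_fintype_card (α := S.Face)]
  omega

/-- The first Betti number of a closed connected surface. -/
theorem finrank_firstCohomology [ConnectedSpace S.Realization] (hS : S.IsClosed) :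
    (Module.finrank ℚ S.FirstCohomology : ℤ) = 2 - S.eulerChar := by
  have h1 := Submodule.finrank_quotient_add_finrank (S.coboundaries.submoduleOf S.cocycles)
  rw [(Submodule.submoduleOfEquivOfLe S.coboundaries_le_cocycles).finrank_eq] at h1
  have h2 := S.finrank_coboundaries
  change Module.finrank ℚ S.FirstCohomology + Module.finrank ℚ S.coboundaries = _ at h1
  have h3 := S.finrank_cocycles hS
  rw [eulerChar]
  -- The difference of the dimensions E - F + 1 and V - 1.
  omega

end PolygonalSurface

/-! ### The surface of a decorated Gauss diagram. -/

theorem DecoratedGaussDiagram.eulerChar_surface (G : DecoratedGaussDiagram)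
    (κ : PolygonalSurface.Cut G.colour) :
    (G.surface κ).eulerChar = G.cycles - G.chords - 2 * G.excess := by
  rw [surface, PolygonalSurface.eulerChar_capped, G.eulerChar_ribbonGraph, excess, cycles]
  ring

theorem mainTheorem3 (G : DecoratedGaussDiagram) (κ : PolygonalSurface.Cut G.colour) :
    (G.surface κ).IsClosed ∧
    ((G.surface κ).eulerChar : ℚ) =
      2 - 2 * (1 + (G.excess : ℚ) + ((G.chords : ℚ) - (G.cycles : ℚ)) / 2) ∧
    (ConnectedSpace (G.surface κ).Realization →
      ∃ g : ℕ, (G.surface κ).HasGenus g ∧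
        (g : ℚ) = 1 + (G.excess : ℚ) + ((G.chords : ℚ) - (G.cycles : ℚ)) / 2) := by
  have hclosed : (G.surface κ).IsClosed := PolygonalSurface.isClosed_capped κ
  have hχ : ((G.surface κ).eulerChar : ℚ) =
      2 - 2 * (1 + (G.excess : ℚ) + ((G.chords : ℚ) - (G.cycles : ℚ)) / 2) := by
    rw [G.eulerChar_surface κ]
    push_cast
    ring
  refine ⟨hclosed, hχ, fun hconn => ?_⟩
  have hb := (G.surface κ).finrank_firstCohomology hclosed
  obtain ⟨r, hr⟩ := (G.surface κ).even_eulerChar hclosed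
  -- The Betti number is 2 - 2r and is nonnegative, so `toNat` loses nothing.
  obtain ⟨g, hg⟩ : ∃ g : ℕ, (g : ℤ) = 1 - r := ⟨(1 - r).toNat, by omega⟩
  refine ⟨g, ⟨hclosed, hconn, by omega⟩, ?_⟩
  have hgq : (g : ℚ) = 1 - r := by exact_mod_cast hg
  rw [hr] at hχ
  push_cast at hχ
  linarith
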